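/- Let $A_1,\dots,A_m\in\mathbb{C}^{n\times n}$, let $Q\in\mathbb{C}^{n\times n}$ be Hermitian positive definite, and let $\xi,\rho,\eta_1,\dots,\eta_m>0$. The equation $X-\sum_{i=1}^m A_i^*X^{-1}A_i=Q$ has a unique Hermitian positive definite solution $X$. For this $X$ put $B_i=X^{-1}A_i$ and $$L=I\otimes I+\sum_{i=1}^m B_i^T\otimes B_i^* ,$$ which is an invertible $n^2\times n^2$ matrix. Let $\Pi$ be the vec-permutation matrix, so that $\operatorname{vec}E^T=\Pi\operatorname{vec}E$ for all $E\in\mathbb{C}^{n\times n}$ (where $\operatorname{vec}$ stacks columns), and define real matrices $S,\Sigma,U_{i1},\Omega_{i1},U_{i2},\Omega_{i2}\in\mathbb{R}^{n^2\times n^2}$ by $$L^{-1}=S+\mathbf{i}\Sigma,\qquad L^{-1}(I\otimes B_i^*)=U_{i1}+\mathbf{i}\Omega_{i1},\qquad L^{-1}(B_i^T\otimes I)\Pi=U_{i2}+\mathbf{i}\Omega_{i2},$$ and set $$S_c=\begin{bmatrix}S&-\Sigma\\ \Sigma&S\end{bmatrix},\qquad U_i=\begin{bmatrix}U_{i1}+U_{i2}&\Omega_{i2}-\Omega_{i1}\\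 \Omega_{i1}+\Omega_{i2}&U_{i1}-U_{i2}\end{bmatrix}\quad(i=1,\dots,m).$$ Then the limit defining the condition number $$c(X)=\lim_{\delta\to0^+}\ \sup_{\left\|\left(\frac{\Delta A_1}{\eta_1},\dots,\frac{\Delta A_m}{\eta_m},\frac{\Delta Q}{\rho}\right)\right\|_F\le\delta}\frac{\|\Delta X\|_F}{\xi\,\delta}$$ exists, where the supremum is over $\Delta A_i\in\mathbb{C}^{n\times n}$ and Hermitian $\Delta Q$ with $Q+\Delta Q$ positive definite, and $X+\Delta X$ denotes the positive definite solution of the equation with $A_i,Q$ replaced by $A_i+\Delta A_i$, $Q+\Delta Q$; and $$c(X)=\frac1\xi\,\bigl\|(\rho S_c,\ \eta_1U_1,\ \dots,\ \eta_mU_m)\bigr\| ,$$ where $\|\cdot\|_F$ is the Frobenius norm and $\|\cdot\|$ is the spectral norm. -/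

import Mathlib

open Filter Topology
open scoped Matrix Kronecker ENNReal ComplexOrder

noncomputable section

namespace MatrixCond

section
open scoped Matrix.Norms.Frobenius

/-- The Frobenius norm of a complex matrix. -/
def frobNorm {r c : Type*} [Fintype r] [Fintype c] (M : Matrix r c ℂ) : ℝ := ‖M‖

end

section
open scoped Matrix.Norms.L2Operator

/-- The spectral norm (operator norm for the Euclidean norms) of a real matrix. -/
def specNorm {r c : Type*} [Fintype r] [Fintype c] [DecidableEq c] (M : Matrix r c ℝ) : ℝ := ‖M‖

end

/-- The block row `(M₁, …, Mₘ)`. -/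
def blockRow {m : ℕ} {r c R : Type*} (M : Fin m → Matrix r c R) : Matrix r (Fin m × c) R :=
  Matrix.of fun i p => M p.1 i p.2

variable {m n : ℕ}

/-- `X` is a positive definite solution of `X - ∑ᵢ Aᵢ* X⁻¹ Aᵢ = Q`. -/
def IsPosDefSolution (A : Fin m → Matrix (Fin n) (Fin n) ℂ) (Q X : Matrix (Fin n) (Fin n) ℂ) :
    Prop :=
  X.PosDef ∧ X - ∑ i, (A i)ᴴ * X⁻¹ * A i = Q

/-- `‖(ΔA₁/η₁, …, ΔAₘ/ηₘ, ΔQ/ρ)‖_F`. -/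
def perturbationNorm (η : Fin m → ℝ) (ρ : ℝ) (ΔA : Fin m → Matrix (Fin n) (Fin n) ℂ)
    (ΔQ : Matrix (Fin n) (Fin n) ℂ) : ℝ :=
  frobNorm (Matrix.fromCols (blockRow fun i => (η i)⁻¹ • ΔA i) (ρ⁻¹ • ΔQ))

/-- The supremum (in `[0, ∞]`) of `‖ΔX‖_F / (ξ δ)` over all perturbations of weighted size at most
`δ`, with `ΔQ` Hermitian and `Q + ΔQ` positive definite, where `X + ΔX` is a positive definite
solution of the perturbed equation. -/
def perturbationSup (ξ : ℝ) (η : Fin m → ℝ) (ρ : ℝ) (A : Fin m → Matrix (Fin n) (Fin n) ℂ)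
    (Q X : Matrix (Fin n) (Fin n) ℂ) (δ : ℝ) : ℝ≥0∞ :=
  ⨆ (ΔA : Fin m → Matrix (Fin n) (Fin n) ℂ) (ΔQ : Matrix (Fin n) (Fin n) ℂ)
    (ΔX : Matrix (Fin n) (Fin n) ℂ)
    (_ : perturbationNorm η ρ ΔA ΔQ ≤ δ ∧ ΔQ.IsHermitian ∧ (Q + ΔQ).PosDef ∧
      IsPosDefSolution (fun i => A i + ΔA i) (Q + ΔQ) (X + ΔX)),
    ENNReal.ofReal (frobNorm ΔX / (ξ * δ))

/-- `c` is the Rice condition number of the solution `X`: the limit of `perturbationSup` as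
`δ → 0⁺`, which in particular exists. -/
def IsConditionNumber (ξ : ℝ) (η : Fin m → ℝ) (ρ : ℝ) (A : Fin m → Matrix (Fin n) (Fin n) ℂ)
    (Q X : Matrix (Fin n) (Fin n) ℂ) (c : ℝ≥0∞) : Prop :=
  Tendsto (perturbationSup ξ η ρ A Q X) (𝓝[>] 0) (𝓝 c)

/-- `Bᵢ = X⁻¹ Aᵢ`. -/
def matB (A : Fin m → Matrix (Fin n) (Fin n) ℂ) (X : Matrix (Fin n) (Fin n) ℂ) (i : Fin m) :
    Matrix (Fin n) (Fin n) ℂ :=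
  X⁻¹ * A i

/-- `L = I ⊗ I + ∑ᵢ Bᵢᵀ ⊗ Bᵢ*`. -/
def matL (A : Fin m → Matrix (Fin n) (Fin n) ℂ) (X : Matrix (Fin n) (Fin n) ℂ) :
    Matrix (Fin n × Fin n) (Fin n × Fin n) ℂ :=
  (1 : Matrix (Fin n) (Fin n) ℂ) ⊗ₖ (1 : Matrix (Fin n) (Fin n) ℂ) +
    ∑ i, (matB A X i)ᵀ ⊗ₖ (matB A X i)ᴴ

/-- The vec-permutation matrix `Π`, with `vec Eᵀ = Π vec E`. -/
def vecPerm (n : ℕ) : Matrix (Fin n × Fin n) (Fin n × Fin n) ℂ :=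
  Matrix.of fun p q => if q = p.swap then 1 else 0

theorem vecPerm_mulVec_vec (E : Matrix (Fin n) (Fin n) ℂ) :
    vecPerm n *ᵥ E.vec = Eᵀ.vec := by
  ext p
  simp [vecPerm, Matrix.mulVec, dotProduct, Matrix.vec]

/-- Entrywise real part. -/
def rePart {r c : Type*} (M : Matrix r c ℂ) : Matrix r c ℝ := M.map Complex.re

/-- Entrywise imaginary part. -/
def imPart {r c : Type*} (M : Matrix r c ℂ) : Matrix r c ℝ := M.map Complex.im

/-- `S_c = [S, -Σ; Σ, S]`, where `L⁻¹ = S + 𝐢 Σ`. -/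
def matSc (A : Fin m → Matrix (Fin n) (Fin n) ℂ) (X : Matrix (Fin n) (Fin n) ℂ) :
    Matrix ((Fin n × Fin n) ⊕ (Fin n × Fin n)) ((Fin n × Fin n) ⊕ (Fin n × Fin n)) ℝ :=
  Matrix.fromBlocks (rePart (matL A X)⁻¹) (-imPart (matL A X)⁻¹)
    (imPart (matL A X)⁻¹) (rePart (matL A X)⁻¹)

/-- `L⁻¹ (I ⊗ Bᵢ*) = U_{i1} + 𝐢 Ω_{i1}`. -/
def matV1 (A : Fin m → Matrix (Fin n) (Fin n) ℂ) (X : Matrix (Fin n) (Fin n) ℂ) (i : Fin m) :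
    Matrix (Fin n × Fin n) (Fin n × Fin n) ℂ :=
  (matL A X)⁻¹ * ((1 : Matrix (Fin n) (Fin n) ℂ) ⊗ₖ (matB A X i)ᴴ)

/-- `L⁻¹ (Bᵢᵀ ⊗ I) Π = U_{i2} + 𝐢 Ω_{i2}`. -/
def matV2 (A : Fin m → Matrix (Fin n) (Fin n) ℂ) (X : Matrix (Fin n) (Fin n) ℂ) (i : Fin m) :
    Matrix (Fin n × Fin n) (Fin n × Fin n) ℂ :=
  (matL A X)⁻¹ * ((matB A X i)ᵀ ⊗ₖ (1 : Matrix (Fin n) (Fin n) ℂ)) * vecPerm n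

/-- `Uᵢ = [U_{i1} + U_{i2}, Ω_{i2} - Ω_{i1}; Ω_{i1} + Ω_{i2}, U_{i1} - U_{i2}]`. -/
def matU (A : Fin m → Matrix (Fin n) (Fin n) ℂ) (X : Matrix (Fin n) (Fin n) ℂ) (i : Fin m) :
    Matrix ((Fin n × Fin n) ⊕ (Fin n × Fin n)) ((Fin n × Fin n) ⊕ (Fin n × Fin n)) ℝ :=
  Matrix.fromBlocks
    (rePart (matV1 A X i) + rePart (matV2 A X i)) (imPart (matV2 A X i) - imPart (matV1 A X i))
    (imPart (matV1 A X i) + imPart (matV2 A X i)) (rePart (matV1 A X i) - rePart (matV2 A X i))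

end MatrixCond

end

/-
The order relation `t X ≤ Y ∧ t Y ≤ X` with the largest possible `t ≤ 1` measures how far two
positive definite matrices are apart, and `X ↦ Q + ∑ᵢ Aᵢ* X⁻¹ Aᵢ` strictly increases `t` unless
`t = 1`; with compactness this gives existence and uniqueness of the positive definite solution.
Since `X - ∑ᵢ Bᵢ* X Bᵢ = Q` is positive definite, `Z ↦ Z + ∑ᵢ Bᵢ* Z Bᵢ` is injective: if `c` is the
least number with `-c X ≤ Z ≤ c X`, then `Z = -∑ᵢ Bᵢ* Z Bᵢ` forces `c = 0`. So the implicit function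
theorem makes `X` a differentiable function of `(A, Q)`, and the condition number is the operator
norm of its derivative on the perturbations with Hermitian `ΔQ`. Dropping the Hermitian constraint
does not change this norm, because Hermitian and skew-Hermitian `ΔQ` are orthogonal and have
orthogonal responses; the matrix of the unconstrained derivative in real coordinates is
`(ρ S_c, η₁ U₁, …, ηₘ Uₘ)`.
-/

noncomputable section

namespace MatrixCond

open Ring

section StarRing

variable {κ R : Type*} [Fintype κ] [Ring R] [StarRing R]

/-- The map `X ↦ Q + ∑ᵢ Aᵢ* X⁻¹ Aᵢ`, whose fixed points are the solutions of
`X - ∑ᵢ Aᵢ* X⁻¹ Aᵢ = Q`. -/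
def fixedPointMap (A : κ → R) (Q X : R) : R := Q + ∑ i, star (A i) * X⁻¹ʳ * A i

theorem star_fixedPointMap (A : κ → R) (Q X : R) :
    star (fixedPointMap A Q X) = fixedPointMap A (star Q) (star X) := by
  simp [fixedPointMap, star_sum, Ring.inverse_star, mul_assoc]

variable [Algebra ℂ R] [TopologicalSpace R] [IsTopologicalRing R]

/-- The Stein operator `Z ↦ Z + ∑ᵢ Bᵢ* Z Bᵢ`. -/
def steinMap (B : κ → R) : R →L[ℂ] R where
  toFun Z := Z + ∑ i, star (B i) * Z * B i
  map_add' Z W := by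
    simp only [mul_add, add_mul, Finset.sum_add_distrib]
    abel
  map_smul' c Z := by simp [Finset.smul_sum]

theorem steinMap_apply (B : κ → R) (Z : R) : steinMap B Z = Z + ∑ i, star (B i) * Z * B i :=
  rfl

theorem steinMap_star (B : κ → R) (Z : R) : steinMap B (star Z) = star (steinMap B Z) := by
  simp [steinMap_apply, star_sum, mul_assoc]

variable [ContinuousStar R] [StarModule ℂ R]

/-- The first-order change `F + ∑ᵢ (Eᵢ* Bᵢ + Bᵢ* Eᵢ)` of the data of the equation when `(A, Q)`
moves in the direction `(E, F)`. -/
def sourceMap (B : κ → R) : (κ → R) × R →L[ℝ] R where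
  toFun p := p.2 + ∑ i, (star (p.1 i) * B i + star (B i) * p.1 i)
  map_add' p q := by
    simp only [Prod.fst_add, Prod.snd_add, Pi.add_apply, star_add, mul_add, add_mul,
      Finset.sum_add_distrib]
    abel
  map_smul' c p := by simp [Finset.smul_sum]

theorem sourceMap_apply (B E : κ → R) (F : R) :
    sourceMap B (E, F) = F + ∑ i, (star (E i) * B i + star (B i) * E i) :=
  rfl

/-- The derivative `(E, F) ↦ Z` of the solution of `X - ∑ᵢ Aᵢ* X⁻¹ Aᵢ = Q` with respect to
`(A, Q)`, where `Z + ∑ᵢ Bᵢ* Z Bᵢ = F + ∑ᵢ (Eᵢ* Bᵢ + Bᵢ* Eᵢ)` and `Bᵢ = X⁻¹ Aᵢ`. -/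
def solutionDeriv (B : κ → R) : (κ → R) × R →L[ℝ] R :=
  (steinMap B).inverse.restrictScalars ℝ ∘L sourceMap B

theorem steinMap_solutionDeriv {B : κ → R} (hB : (steinMap B).IsInvertible) (p : (κ → R) × R) :
    steinMap B (solutionDeriv B p) = sourceMap B p :=
  hB.self_apply_inverse _

theorem isSelfAdjoint_solutionDeriv {B : κ → R} (hB : (steinMap B).IsInvertible) (E : κ → R)
    {F : R} (hF : IsSelfAdjoint F) : IsSelfAdjoint (solutionDeriv B (E, F)) := by
  have hsource : star (sourceMap B (E, F)) = sourceMap B (E, F) := by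
    simp [sourceMap_apply, star_sum, hF.star_eq, add_comm]
  refine hB.injective ?_
  rw [steinMap_star, steinMap_solutionDeriv hB, hsource]

theorem solutionDeriv_add_I_smul (B E : κ → R) (H G : R) :
    solutionDeriv B (E, H + Complex.I • G) =
      solutionDeriv B (E, H) + Complex.I • solutionDeriv B (0, G) := by
  simp only [solutionDeriv, ContinuousLinearMap.comp_apply,
    ContinuousLinearMap.coe_restrictScalars', sourceMap_apply, ← map_smul, ← map_add]
  congr 1
  simp only [Pi.zero_apply, star_zero, zero_mul, mul_zero, add_zero, Finset.sum_const_zero]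
  abel

end StarRing

section ImplicitFunction

theorem exists_hasFDerivAt_implicit {P R : Type*} [NormedAddCommGroup P] [NormedSpace ℝ P]
    [CompleteSpace P] [NormedAddCommGroup R] [NormedSpace ℝ R] [CompleteSpace R]
    {f : P × R → R} {e : R ≃L[ℝ] R} {S : P →L[ℝ] R} {x : P} {y : R}
    (hf : HasStrictFDerivAt f ((e : R →L[ℝ] R) ∘L .snd ℝ P R - S ∘L .fst ℝ P R) (x, y)) :
    ∃ φ : P → R, φ x = y ∧ HasFDerivAt φ ((e.symm : R →L[ℝ] R) ∘L S) x ∧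
      (∀ᶠ p in 𝓝 x, f (p, φ p) = f (x, y)) ∧
      ∀ᶠ q in 𝓝 (x, y), f q = f (x, y) ↔ φ q.1 = q.2 := by
  set f' := (e : R →L[ℝ] R) ∘L .snd ℝ P R - S ∘L .fst ℝ P R with hf'
  have hinr : f' ∘L .inr ℝ P R = e := by
    ext z
    simp [hf']
  have hinl : f' ∘L .inl ℝ P R = -S := by
    ext p
    simp [hf']
  have hinv : (f' ∘L .inr ℝ P R).IsInvertible := ⟨e, hinr.symm⟩
  have hiff := hf.eventually_apply_eq_iff_implicitFunctionOfProdDomain hinv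
  have hderiv := (hf.hasStrictFDerivAt_implicitFunctionOfProdDomain hinv).hasFDerivAt
  refine ⟨hf.implicitFunctionOfProdDomain hinv, hiff.self_of_nhds.1 rfl,
    hderiv.congr_fderiv ?_, hf.eventually_apply_implicitFunctionOfProdDomain hinv, hiff⟩
  rw [hinl, hinr, ContinuousLinearMap.inverse_equiv]
  ext p
  simp

variable {κ R : Type*} [Fintype κ] [NormedRing R] [NormedAlgebra ℂ R] [StarRing R]
  [ContinuousStar R] [StarModule ℂ R] [CompleteSpace R] {A : κ → R} {Q X : R}

theorem hasStrictFDerivAt_sub_fixedPointMap (hX : IsUnit X) (hsa : IsSelfAdjoint X) :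
    HasStrictFDerivAt (fun p : ((κ → R) × R) × R => p.2 - fixedPointMap p.1.1 p.1.2 p.2)
      ((steinMap fun i => X⁻¹ʳ * A i).restrictScalars ℝ ∘L .snd ℝ _ _ -
        sourceMap (fun i => X⁻¹ʳ * A i) ∘L .fst ℝ _ _) ((A, Q), X) := by
  obtain ⟨x, rfl⟩ := hX
  have hfst := hasStrictFDerivAt_fst (𝕜 := ℝ) (p := ((A, Q), (x : R)))
  have hsnd := hasStrictFDerivAt_snd (𝕜 := ℝ) (p := ((A, Q), (x : R)))
  have hA (i : κ) := (hasStrictFDerivAt_apply (𝕜 := ℝ) i A).comp _ hfst.fst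
  have hinv := (hasStrictFDerivAt_ringInverse (𝕜 := ℝ) x).comp ((A, Q), (x : R)) hsnd
  have h := hsnd.sub (hfst.snd.add (HasStrictFDerivAt.fun_sum fun i (_ : i ∈ Finset.univ) =>
    ((hA i).star.mul' hinv).mul' (hA i)))
  refine h.congr_fderiv (ContinuousLinearMap.ext ?_)
  rintro ⟨⟨E, F⟩, Z⟩
  have hxi : star (↑x⁻¹ : R) = ↑x⁻¹ := by
    rw [← Ring.inverse_unit, ← Ring.inverse_star, hsa.star_eq]
  simp only [Pi.mul_apply, inverse_invertible, invOf_units, ContinuousLinearMap.neg_comp, smul_neg,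
    smul_add, Finset.sum_add_distrib, Finset.sum_neg_distrib, sub_apply,
    ContinuousLinearMap.coe_snd', add_apply, ContinuousLinearMap.comp_apply,
    ContinuousLinearMap.coe_fst', sum_apply, smul_apply, ContinuousLinearMap.proj_apply,
    smul_eq_mul, mul_assoc, neg_apply, ContinuousLinearMap.mulLeftRight_apply,
    MulOpposite.smul_eq_mul_unop, MulOpposite.unop_op, ContinuousLinearEquiv.coe_coe,
    starL'_apply, ContinuousLinearMap.coe_restrictScalars', steinMap_apply, star_mul, hxi,
    sourceMap_apply]
  abel

theorem exists_hasFDerivAt_solution (hX : IsUnit X) (hsa : IsSelfAdjoint X)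
    (hfix : fixedPointMap A Q X = X) (hinv : (steinMap fun i => X⁻¹ʳ * A i).IsInvertible) :
    ∃ φ : (κ → R) × R → R, φ (A, Q) = X ∧
      HasFDerivAt φ (solutionDeriv fun i => X⁻¹ʳ * A i) (A, Q) ∧
      ∀ᶠ p in 𝓝 (A, Q), fixedPointMap p.1 p.2 (φ p) = φ p ∧
        (IsSelfAdjoint p.2 → IsSelfAdjoint (φ p)) := by
  obtain ⟨e, he⟩ := hinv
  have hf := hasStrictFDerivAt_sub_fixedPointMap (A := A) (Q := Q) hX hsa
  rw [← he] at hf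
  obtain ⟨φ, hval, hderiv, hsol, hiff⟩ := exists_hasFDerivAt_implicit (e := e.restrictScalars ℝ) hf
  have hsolutionDeriv : (solutionDeriv fun i => X⁻¹ʳ * A i) =
      ((e.restrictScalars ℝ).symm : R →L[ℝ] R) ∘L sourceMap fun i => X⁻¹ʳ * A i := by
    rw [solutionDeriv, ← he, ContinuousLinearMap.inverse_equiv]
    rfl
  have hstar : Tendsto (fun p => (p, star (φ p))) (𝓝 (A, Q)) (𝓝 ((A, Q), X)) := by
    have hstarφ := hderiv.continuousAt.star
    rw [ContinuousAt, hval, hsa.star_eq] at hstarφ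
    exact tendsto_id.prodMk_nhds hstarφ
  refine ⟨φ, hval, hsolutionDeriv ▸ hderiv, ?_⟩
  simp only [hfix, sub_self, sub_eq_zero] at hsol hiff
  filter_upwards [hsol, hstar.eventually hiff] with p hp hp_iff
  refine ⟨hp.symm, fun hpsa => (hp_iff.1 ?_).symm⟩
  conv_rhs => rw [← hpsa.star_eq, ← star_fixedPointMap, ← hp]

end ImplicitFunction

section Order

variable {κ R : Type*} [Fintype κ] [CStarAlgebra R] [PartialOrder R] [StarOrderedRing R]

theorem eventually_isStrictlyPositive {X : R} (hX : IsStrictlyPositive X) :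
    ∀ᶠ Y in 𝓝 X, IsSelfAdjoint Y → IsStrictlyPositive Y := by
  nontriviality R
  obtain ⟨r, hr, hrX⟩ : ∃ r > 0, algebraMap ℝ R r ≤ X :=
    (CFC.exists_pos_algebraMap_le_iff hX.isSelfAdjoint).2 fun x hx => hX.spectrum_pos hx
  filter_upwards [Metric.ball_mem_nhds X hr] with Y hY hYsa
  rw [Metric.mem_ball, dist_comm, dist_eq_norm] at hY
  have hXY : X - Y ≤ algebraMap ℝ R ‖X - Y‖ := (hX.isSelfAdjoint.sub hYsa).le_algebraMap_norm_self
  have hgap : IsStrictlyPositive (algebraMap ℝ R (r - ‖X - Y‖)) :=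
    isStrictlyPositive_algebraMap (sub_pos.2 hY)
  refine hgap.of_le ?_
  rw [map_sub]
  calc algebraMap ℝ R r - algebraMap ℝ R ‖X - Y‖ ≤ X - (X - Y) := sub_le_sub hrX hXY
    _ = Y := sub_sub_cancel X Y

theorem eventually_smul_le {Q Z : R} (hQ : IsStrictlyPositive Q) (hZ : IsSelfAdjoint Z) :
    ∀ᶠ c : ℝ in 𝓝[>] 0, c • Z ≤ Q := by
  have hlim : Tendsto (fun c : ℝ => Q - c • Z) (𝓝 0) (𝓝 Q) :=
    Continuous.tendsto' (by fun_prop) _ _ (by simp)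
  filter_upwards [(hlim.mono_left nhdsWithin_le_nhds).eventually
    (eventually_isStrictlyPositive hQ)] with c hc
  exact sub_nonneg.1 (hc (hQ.isSelfAdjoint.sub (.smul (.all c) hZ))).nonneg

variable {A : κ → R} {Q : R}

theorem le_fixedPointMap {X : R} (hX : IsStrictlyPositive X) : Q ≤ fixedPointMap A Q X :=
  le_add_of_nonneg_right <|
    Finset.sum_nonneg fun i _ => star_left_conjugate_nonneg hX.ringInverse.nonneg (A i)

theorem isStrictlyPositive_fixedPointMap (hQ : IsStrictlyPositive Q) {X : R}
    (hX : IsStrictlyPositive X) : IsStrictlyPositive (fixedPointMap A Q X) :=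
  hQ.of_le (le_fixedPointMap hX)

theorem smul_ringInverse_le {X Y : R} (hY : IsStrictlyPositive Y)
    {t : ℝ} (ht : 0 ≤ t) (h : t • Y ≤ X) : t • X⁻¹ʳ ≤ Y⁻¹ʳ := by
  rcases ht.eq_or_lt with rfl | ht
  · simpa using hY.ringInverse.nonneg
  have htY : IsStrictlyPositive (t • Y) := hY.smul ht
  have hinv : (t • Y)⁻¹ʳ = t⁻¹ • Y⁻¹ʳ := by
    rw [← mul_one (t • Y)⁻¹ʳ, inverse_mul_eq_iff_eq_mul _ _ _ htY.isUnit, smul_mul_smul_comm,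
      mul_inverse_cancel _ hY.isUnit, mul_inv_cancel₀ ht.ne', one_smul]
  exact (le_inv_smul_iff_of_pos ht).1 (hinv ▸ CStarAlgebra.ringInverse_le_ringInverse h htY)

/-- The gain `(1 - t) Q` is what makes `fixedPointMap` contract the order distance. -/
theorem smul_fixedPointMap_add_le {X Y : R} (hY : IsStrictlyPositive Y) {t : ℝ} (ht : 0 ≤ t)
    (h : t • Y ≤ X) : t • fixedPointMap A Q X + (1 - t) • Q ≤ fixedPointMap A Q Y := by
  have hterm : ∀ i, t • (star (A i) * X⁻¹ʳ * A i) ≤ star (A i) * Y⁻¹ʳ * A i := fun i => by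
    simpa using star_left_conjugate_le_conjugate (smul_ringInverse_le hY ht h) (A i)
  calc t • fixedPointMap A Q X + (1 - t) • Q
      = Q + ∑ i, t • (star (A i) * X⁻¹ʳ * A i) := by
        rw [fixedPointMap, smul_add, Finset.smul_sum, sub_smul, one_smul]
        abel
    _ ≤ fixedPointMap A Q Y := by
        unfold fixedPointMap
        gcongr with i
        exact hterm i

theorem fixedPointMap_le_fixedPointMap {X Y : R} (hX : IsStrictlyPositive X) (h : X ≤ Y) :
    fixedPointMap A Q Y ≤ fixedPointMap A Q X := by
  simpa using smul_fixedPointMap_add_le (A := A) (Q := Q) hX zero_le_one (by simpa using h)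

theorem exists_diag_mem_of_isCompact (hQ : IsStrictlyPositive Q) {K : Set (R × R)}
    (hK : IsCompact K) (hne : K.Nonempty)
    (hpos : ∀ p ∈ K, IsStrictlyPositive p.1 ∧ IsStrictlyPositive p.2)
    (hmaps : ∀ p ∈ K, (fixedPointMap A Q p.1, fixedPointMap A Q p.2) ∈ K) :
    ∃ X, (X, X) ∈ K := by
  let C : Set ((R × R) × ℝ) :=
    (K ×ˢ Set.Icc 0 1) ∩ {q | q.2 • q.1.1 ≤ q.1.2 ∧ q.2 • q.1.2 ≤ q.1.1}
  have hC : IsCompact C := by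
    refine (hK.prod isCompact_Icc).inter_right (IsClosed.inter ?_ ?_) <;>
      exact isClosed_le (by fun_prop) (by fun_prop)
  obtain ⟨p, hp⟩ := hne
  have hpC : (p, 0) ∈ C :=
    ⟨⟨hp, by simp⟩, by simpa using (hpos p hp).2.nonneg, by simpa using (hpos p hp).1.nonneg⟩
  obtain ⟨⟨⟨X, Y⟩, t⟩, ⟨⟨hXY, ht0, ht1⟩, htXY, htYX⟩, hmax⟩ :=
    hC.exists_isMaxOn ⟨_, hpC⟩ continuous_snd.continuousOn
  obtain ⟨hX, hY⟩ := hpos _ hXY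
  dsimp only at hXY ht0 ht1 htXY htYX hX hY
  obtain rfl | ht1 := ht1.eq_or_lt
  · rw [one_smul] at htXY htYX
    exact ⟨X, htXY.antisymm htYX ▸ hXY⟩
  have hFX := (isStrictlyPositive_fixedPointMap (A := A) hQ hX).isSelfAdjoint
  have hFY := (isStrictlyPositive_fixedPointMap (A := A) hQ hY).isSelfAdjoint
  obtain ⟨c, hcX, hcY, hc0, hc1⟩ := ((eventually_smul_le hQ hFX).and
    ((eventually_smul_le hQ hFY).and (Ioo_mem_nhdsGT one_pos))).exists
  have improve : ∀ {U V : R}, c • U ≤ Q → t • U + (1 - t) • Q ≤ V →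
      (t + (1 - t) * c) • U ≤ V := fun {U V} hU hV => by
    refine le_trans ?_ hV
    rw [add_smul, mul_smul]
    gcongr
  have hmem : ((fixedPointMap A Q X, fixedPointMap A Q Y), t + (1 - t) * c) ∈ C :=
    ⟨⟨hmaps _ hXY, by nlinarith, by nlinarith⟩,
      improve hcX (smul_fixedPointMap_add_le hY ht0 htYX),
      improve hcY (smul_fixedPointMap_add_le hX ht0 htXY)⟩
  have hle : t + (1 - t) * c ≤ t := hmax hmem
  linarith [mul_pos (sub_pos.2 ht1) hc0]

theorem eq_of_fixedPointMap_eq (hQ : IsStrictlyPositive Q) {X Y : R} (hX : IsStrictlyPositive X)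
    (hY : IsStrictlyPositive Y) (hFX : fixedPointMap A Q X = X) (hFY : fixedPointMap A Q Y = Y) :
    X = Y := by
  obtain ⟨Z, hZ⟩ := exists_diag_mem_of_isCompact (A := A) (K := {(X, Y)}) hQ isCompact_singleton
    (Set.singleton_nonempty _) (by simp [hX, hY]) (by simp [hFX, hFY])
  obtain ⟨rfl, rfl⟩ := Prod.mk.inj hZ
  rfl

theorem isCompact_Icc_of_nonneg [ProperSpace R] {X : R} (hX : 0 ≤ X) (Y : R) :
    IsCompact (Set.Icc X Y) :=
  Metric.isCompact_of_isClosed_isBounded isClosed_Icc <|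
    isBounded_iff_forall_norm_le.2 ⟨‖Y‖, fun _ hZ =>
      CStarAlgebra.norm_le_norm_of_nonneg_of_le (hX.trans hZ.1) hZ.2⟩

theorem exists_fixedPointMap_eq [ProperSpace R] (A : κ → R) (hQ : IsStrictlyPositive Q) :
    ∃ X, IsStrictlyPositive X ∧ fixedPointMap A Q X = X := by
  let I := Set.Icc Q (fixedPointMap A Q Q)
  have hpos : ∀ X ∈ I, IsStrictlyPositive X := fun X hX => hQ.of_le hX.1
  have hmaps : ∀ X ∈ I, fixedPointMap A Q X ∈ I := fun X hX =>
    ⟨le_fixedPointMap (hpos X hX), fixedPointMap_le_fixedPointMap hQ hX.1⟩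
  have hcont : ContinuousOn (fixedPointMap A Q) I := by
    have hinv : ContinuousOn (Ring.inverse : R → R) I := fun X hX => by
      obtain ⟨x, rfl⟩ := (hpos X hX).isUnit
      exact (NormedRing.inverse_continuousAt x).continuousWithinAt
    unfold fixedPointMap
    fun_prop
  have hgraph : IsCompact ((fun X => (X, fixedPointMap A Q X)) '' I) :=
    (isCompact_Icc_of_nonneg hQ.nonneg _).image_of_continuousOn (continuousOn_id.prodMk hcont)
  obtain ⟨X, Y, hY, hXY⟩ := exists_diag_mem_of_isCompact hQ hgraph
    ⟨_, Q, ⟨le_rfl, le_fixedPointMap hQ⟩, rfl⟩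
    (by
      rintro _ ⟨X, hX, rfl⟩
      exact ⟨hpos X hX, hpos _ (hmaps X hX)⟩)
    (by
      rintro _ ⟨X, hX, rfl⟩
      exact ⟨_, hmaps X hX, rfl⟩)
  obtain ⟨rfl, hfix⟩ := Prod.mk.inj hXY
  exact ⟨Y, hpos Y hY, hfix⟩

variable {B : κ → R}

theorem eq_zero_of_isSelfAdjoint_of_steinMap_eq_zero {X Z : R} (hX : IsStrictlyPositive X)
    (hsub : IsStrictlyPositive (X - ∑ i, star (B i) * X * B i)) (hZ : IsSelfAdjoint Z)
    (h : steinMap B Z = 0) : Z = 0 := by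
  obtain ⟨s, hs, hs0, hs1⟩ := ((eventually_smul_le hsub hX.isSelfAdjoint).and
    (Ioo_mem_nhdsGT one_pos)).exists
  rw [steinMap_apply, add_eq_zero_iff_eq_neg] at h
  let S : Set ℝ := {c | 0 ≤ c ∧ Z ≤ c • X ∧ -Z ≤ c • X}
  have hne : S.Nonempty := by
    obtain ⟨c, hc, hc', hc0⟩ := ((eventually_smul_le hX hZ).and
      ((eventually_smul_le hX hZ.neg).and self_mem_nhdsWithin)).exists
    exact ⟨c⁻¹, inv_nonneg.2 (le_of_lt hc0), (le_inv_smul_iff_of_pos hc0).2 hc,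
      (le_inv_smul_iff_of_pos hc0).2 hc'⟩
  have hclosed : IsClosed S :=
    isClosed_Ici.inter ((isClosed_le (by fun_prop) (by fun_prop)).inter
      (isClosed_le (by fun_prop) (by fun_prop)))
  have hbdd : BddBelow S := ⟨0, fun c hc => hc.1⟩
  obtain ⟨hc0, hZc, hZc'⟩ := hclosed.csInf_mem hne hbdd
  set c := sInf S
  have contract : ∀ {U : R}, U ≤ c • X → ∑ i, star (B i) * U * B i ≤ ((1 - s) * c) • X :=
    fun {U} hU =>
      calc ∑ i, star (B i) * U * B i ≤ ∑ i, star (B i) * (c • X) * B i :=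
            Finset.sum_le_sum fun i _ => star_left_conjugate_le_conjugate hU _
        _ = c • (X - (X - ∑ i, star (B i) * X * B i)) := by simp [Finset.smul_sum]
        _ ≤ c • (X - s • X) := by gcongr
        _ = ((1 - s) * c) • X := by module
  have hcS : (1 - s) * c ∈ S := by
    refine ⟨by nlinarith, ?_, ?_⟩
    · rw [h]
      simpa using contract hZc'
    · rw [h, neg_neg]
      exact contract hZc
  have hc : c = 0 := by nlinarith [csInf_le hbdd hcS, hs0]
  simp only [hc, zero_smul] at hZc hZc'
  exact hZc.antisymm (neg_nonpos.1 hZc')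

theorem steinMap_injective {X : R} (hX : IsStrictlyPositive X)
    (hsub : IsStrictlyPositive (X - ∑ i, star (B i) * X * B i)) :
    Function.Injective (steinMap B) := by
  refine (injective_iff_map_eq_zero _).2 fun Z hZ => ?_
  have hstar : steinMap B (star Z) = 0 := by rw [steinMap_star, hZ, star_zero]
  have hre : (realPart Z : R) = 0 :=
    eq_zero_of_isSelfAdjoint_of_steinMap_eq_zero hX hsub (realPart Z).2 (by
      simp [realPart_apply_coe, hZ, hstar, ContinuousLinearMap.map_smul_of_tower])
  have him : (imaginaryPart Z : R) = 0 :=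
    eq_zero_of_isSelfAdjoint_of_steinMap_eq_zero hX hsub (imaginaryPart Z).2 (by
      simp [imaginaryPart_apply_coe, hZ, hstar, ContinuousLinearMap.map_smul_of_tower])
  rw [← realPart_add_I_smul_imaginaryPart Z, hre, him, smul_zero, add_zero]

end Order

section Matrix

variable {m n : ℕ} {A : Fin m → Matrix (Fin n) (Fin n) ℂ} {Q X Y : Matrix (Fin n) (Fin n) ℂ}

theorem isPosDefSolution_iff :
    IsPosDefSolution A Q X ↔ X.PosDef ∧ fixedPointMap A Q X = X := by
  rw [IsPosDefSolution, fixedPointMap, ← Matrix.nonsing_inv_eq_ringInverse, eq_comm,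
    eq_sub_iff_add_eq]
  rfl

section
open scoped Matrix.Norms.L2Operator MatrixOrder

theorem IsPosDefSolution.eq (hQ : Q.PosDef) (hX : IsPosDefSolution A Q X)
    (hY : IsPosDefSolution A Q Y) : X = Y := by
  rw [isPosDefSolution_iff] at hX hY
  exact eq_of_fixedPointMap_eq hQ.isStrictlyPositive hX.1.isStrictlyPositive
    hY.1.isStrictlyPositive hX.2 hY.2

theorem exists_isPosDefSolution (A : Fin m → Matrix (Fin n) (Fin n) ℂ) (hQ : Q.PosDef) :
    ∃ X, IsPosDefSolution A Q X := by
  have : ProperSpace (Matrix (Fin n) (Fin n) ℂ) := FiniteDimensional.proper ℂ _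
  obtain ⟨X, hX, hfix⟩ := exists_fixedPointMap_eq A hQ.isStrictlyPositive
  exact ⟨X, isPosDefSolution_iff.2 ⟨Matrix.isStrictlyPositive_iff_posDef.1 hX, hfix⟩⟩

end

open scoped Matrix.Norms.L2Operator MatrixOrder in
theorem eventually_posDef (hX : X.PosDef) : ∀ᶠ Y in 𝓝 X, Y.IsHermitian → Y.PosDef := by
  filter_upwards [eventually_isStrictlyPositive hX.isStrictlyPositive] with Y hY hYh
  exact Matrix.isStrictlyPositive_iff_posDef.1 (hY hYh)

open scoped Matrix.Norms.L2Operator MatrixOrder in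
theorem IsPosDefSolution.steinMap_injective (hQ : Q.PosDef) (hX : IsPosDefSolution A Q X) :
    Function.Injective (steinMap (matB A X)) := by
  have hterm : ∀ i, (matB A X i)ᴴ * X * matB A X i = (A i)ᴴ * X⁻¹ * A i := fun i => by
    rw [matB, Matrix.conjTranspose_mul, hX.1.inv.isHermitian.eq, Matrix.mul_assoc _ X,
      Matrix.mul_nonsing_inv_cancel_left _ _ ((Matrix.isUnit_iff_isUnit_det _).1 hX.1.isUnit)]
  refine MatrixCond.steinMap_injective hX.1.isStrictlyPositive ?_
  simpa only [Matrix.star_eq_conjTranspose, hterm, hX.2] using hQ.isStrictlyPositive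

theorem IsPosDefSolution.isInvertible_steinMap (hQ : Q.PosDef) (hX : IsPosDefSolution A Q X) :
    (steinMap (matB A X)).IsInvertible :=
  ⟨(LinearEquiv.ofInjectiveEndo _ (hX.steinMap_injective hQ)).toContinuousLinearEquiv, rfl⟩

theorem matL_mulVec_vec (Z : Matrix (Fin n) (Fin n) ℂ) :
    matL A X *ᵥ Z.vec = (steinMap (matB A X) Z).vec := by
  simp [matL, steinMap_apply, Matrix.add_mulVec, Matrix.sum_mulVec, Matrix.kronecker_mulVec_vec,
    Matrix.vec_sum, Matrix.star_eq_conjTranspose]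

theorem IsPosDefSolution.isUnit_matL (hQ : Q.PosDef) (hX : IsPosDefSolution A Q X) :
    IsUnit (matL A X) := by
  refine Matrix.mulVec_injective_iff_isUnit.1 fun x y hxy => ?_
  obtain ⟨Z, rfl⟩ := Matrix.vec_bijective.surjective x
  obtain ⟨W, rfl⟩ := Matrix.vec_bijective.surjective y
  simp only [matL_mulVec_vec, Matrix.vec_inj] at hxy
  rw [hX.steinMap_injective hQ hxy]

open scoped Matrix.Norms.Frobenius in
theorem IsPosDefSolution.exists_hasFDerivAt (hQ : Q.PosDef) (hX : IsPosDefSolution A Q X) :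
    ∃ φ : (Fin m → Matrix (Fin n) (Fin n) ℂ) × Matrix (Fin n) (Fin n) ℂ → Matrix (Fin n) (Fin n) ℂ,
      φ (A, Q) = X ∧ HasFDerivAt φ (solutionDeriv (matB A X)) (A, Q) ∧
      ∀ᶠ p in 𝓝 (A, Q), p.2.IsHermitian → IsPosDefSolution p.1 p.2 (φ p) := by
  have hB : (fun i => X⁻¹ʳ * A i) = matB A X := by
    ext1 i
    rw [matB, Matrix.nonsing_inv_eq_ringInverse]
  have : CompleteSpace (Matrix (Fin n) (Fin n) ℂ) := FiniteDimensional.complete ℂ _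
  obtain ⟨φ, hφX, hφ, hsol⟩ := exists_hasFDerivAt_solution hX.1.isUnit hX.1.isHermitian
    (isPosDefSolution_iff.1 hX).2 (hB ▸ hX.isInvertible_steinMap hQ)
  have hpos := hφ.continuousAt.eventually (eventually_posDef (hφX ▸ hX.1))
  refine ⟨φ, hφX, hB ▸ hφ, ?_⟩
  filter_upwards [hsol, hpos] with p ⟨hfix, hsa⟩ hp hherm
  exact isPosDefSolution_iff.2 ⟨hp (hsa hherm), hfix⟩

end Matrix

section Rice

variable {V W : Type*} [NormedAddCommGroup V] [NormedSpace ℝ V] [NormedAddCommGroup W]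
  [NormedSpace ℝ W]

theorem tendsto_iSup_norm_sub_div {f : V → W} {T : V →L[ℝ] W} {x : V} (h : HasFDerivAt f T x) :
    Tendsto (fun δ : ℝ => ⨆ (v : V) (_ : ‖v‖ ≤ δ), ENNReal.ofReal (‖f (x + v) - f x‖ / δ))
      (𝓝[>] 0) (𝓝 (ENNReal.ofReal ‖T‖)) := by
  refine tendsto_order.2 ⟨fun a ha => ?_, fun b hb => ?_⟩
  · obtain ⟨v, hv, hav⟩ := T.exists_lt_apply_of_lt_opNorm
      ((ENNReal.lt_ofReal_iff_toReal_lt ha.ne_top).1 ha)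
    have hslope := (h.hasLineDerivAt v).tendsto_slope_zero_right.norm.eventually_const_lt hav
    filter_upwards [hslope, self_mem_nhdsWithin] with δ hδ (hδ0 : 0 < δ)
    have hδv : ‖δ • v‖ ≤ δ := by
      rw [norm_smul, Real.norm_of_nonneg hδ0.le]
      exact mul_le_of_le_one_right hδ0.le hv.le
    refine lt_of_lt_of_le ?_ (le_iSup₂_of_le (δ • v) hδv le_rfl)
    rwa [ENNReal.lt_ofReal_iff_toReal_lt ha.ne_top, div_eq_inv_mul,
      ← Real.norm_of_nonneg (inv_nonneg.2 hδ0.le), ← norm_smul]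
  · obtain ⟨c, hTc, hcb⟩ := ENNReal.lt_iff_exists_nnreal_btwn.1 hb
    have hTc : ‖T‖ < c := ENNReal.ofReal_lt_coe_iff (by positivity) |>.1 hTc
    obtain ⟨r, hr, hball⟩ := Metric.eventually_nhds_iff_ball.1
      ((hasFDerivAt_iff_isLittleO_nhds_zero.1 h).bound (sub_pos.2 hTc))
    filter_upwards [Ioo_mem_nhdsGT hr] with δ ⟨hδ0, hδr⟩
    refine (iSup₂_le fun v hv => ?_).trans_lt hcb
    have hrem : ‖f (x + v) - f x - T v‖ ≤ (c - ‖T‖) * ‖v‖ :=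
      hball v (mem_ball_zero_iff.2 (hv.trans_lt hδr))
    have hfv : ‖f (x + v) - f x‖ ≤ c * δ :=
      calc ‖f (x + v) - f x‖ ≤ ‖f (x + v) - f x - T v‖ + ‖T v‖ := norm_le_norm_sub_add _ _
        _ ≤ (c - ‖T‖) * ‖v‖ + ‖T‖ * ‖v‖ := add_le_add hrem (T.le_opNorm v)
        _ = c * ‖v‖ := by ring
        _ ≤ c * δ := by gcongr
    rw [← ENNReal.ofReal_coe_nnreal]
    exact ENNReal.ofReal_le_ofReal ((div_le_iff₀ hδ0).2 hfv)

theorem tendsto_iSup_norm_sub_div_mul {f : V → W} {T : V →L[ℝ] W} {x : V}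
    (h : HasFDerivAt f T x) {ξ : ℝ} (hξ : 0 < ξ) :
    Tendsto (fun δ : ℝ => ⨆ (v : V) (_ : ‖v‖ ≤ δ), ENNReal.ofReal (‖f (x + v) - f x‖ / (ξ * δ)))
      (𝓝[>] 0) (𝓝 (ENNReal.ofReal ((1 / ξ) * ‖T‖))) := by
  have hscale := tendsto_iSup_norm_sub_div (h.const_smul ξ⁻¹)
  simpa only [Pi.smul_apply, ← smul_sub, norm_smul, Real.norm_of_nonneg (inv_nonneg.2 hξ.le),
    mul_comm ξ⁻¹ ‖f _ - f _‖, ← div_eq_mul_inv, div_div, one_div] using hscale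

theorem norm_comp_subtypeL_eq (T : V →L[ℝ] W) (S : Submodule ℝ V)
    (h : ∀ v, ∃ x ∈ S, ∃ y ∈ S, ‖v‖ ^ 2 = ‖x‖ ^ 2 + ‖y‖ ^ 2 ∧
      ‖T v‖ ^ 2 ≤ ‖T x‖ ^ 2 + ‖T y‖ ^ 2) :
    ‖T ∘L S.subtypeL‖ = ‖T‖ := by
  set K := ‖T ∘L S.subtypeL‖
  have hK0 : 0 ≤ K := norm_nonneg (T ∘L S.subtypeL)
  have hK : ∀ x ∈ S, ‖T x‖ ≤ K * ‖x‖ := fun x hx => (T ∘L S.subtypeL).le_opNorm ⟨x, hx⟩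
  refine le_antisymm ?_ (T.opNorm_le_bound hK0 fun v => ?_)
  · exact ContinuousLinearMap.opNorm_le_bound _ (norm_nonneg T) fun x => T.le_opNorm x
  · obtain ⟨x, hx, y, hy, hv, hTv⟩ := h v
    refine le_of_sq_le_sq ?_ (by positivity)
    calc ‖T v‖ ^ 2 ≤ ‖T x‖ ^ 2 + ‖T y‖ ^ 2 := hTv
      _ ≤ (K * ‖x‖) ^ 2 + (K * ‖y‖) ^ 2 := by gcongr <;> exact hK _ ‹_›
      _ = (K * ‖v‖) ^ 2 := by rw [mul_pow _ ‖v‖, hv]; ring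

end Rice

section Realification

/-- The index type of the real and imaginary parts of the entries of an `n × n` matrix. -/
abbrev RealIndex (n : ℕ) := (Fin n × Fin n) ⊕ (Fin n × Fin n)

/-- A complex vector as the real vector of its real and imaginary parts. -/
def realify {ι : Type*} : (ι → ℂ) →ₗ[ℝ] ι ⊕ ι → ℝ where
  toFun v := Sum.elim (fun i => (v i).re) fun i => (v i).im
  map_add' v w := by ext (i | i) <;> simp
  map_smul' t v := by ext (i | i) <;> simp

theorem realify_inl {ι : Type*} (v : ι → ℂ) (i : ι) : realify v (.inl i) = (v i).re :=
  rfl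

theorem realify_inr {ι : Type*} (v : ι → ℂ) (i : ι) : realify v (.inr i) = (v i).im :=
  rfl

theorem fromBlocks_mulVec_realify {ι : Type*} [Fintype ι] (P R : Matrix ι ι ℂ) (v : ι → ℂ) :
    Matrix.fromBlocks (rePart P + rePart R) (imPart R - imPart P) (imPart P + imPart R)
      (rePart P - rePart R) *ᵥ realify v = realify (P *ᵥ v + R *ᵥ star v) := by
  ext (i | i) <;>
    simp only [Matrix.mulVec, dotProduct, Fintype.sum_sum_type, Matrix.fromBlocks_apply₁₁,
      Matrix.fromBlocks_apply₁₂, Matrix.fromBlocks_apply₂₁, Matrix.fromBlocks_apply₂₂,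
      realify_inl, realify_inr, Pi.add_apply, Complex.add_re, Complex.add_im, Complex.re_sum,
      Complex.im_sum, ← Finset.sum_add_distrib] <;>
    refine Finset.sum_congr rfl fun j _ => ?_ <;>
    simp only [rePart, imPart, Matrix.add_apply, Matrix.sub_apply, Matrix.map_apply, Complex.mul_re,
      Complex.mul_im, Pi.star_apply, RCLike.star_def, Complex.conj_re, Complex.conj_im] <;>
    ring

variable {m n : ℕ}

open scoped Matrix.Norms.Frobenius

theorem frobenius_norm_sq {r c : Type*} [Fintype r] [Fintype c] (M : Matrix r c ℂ) :
    ‖M‖ ^ 2 = ∑ i, ∑ j, ‖M i j‖ ^ 2 := by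
  rw [Matrix.frobenius_norm_def, ← Real.sqrt_eq_rpow, Real.sq_sqrt (by positivity)]
  norm_cast

theorem frobenius_norm_add_I_smul_sq {ι : Type*} [Fintype ι] {H G : Matrix ι ι ℂ}
    (hH : H.IsHermitian) (hG : G.IsHermitian) :
    ‖H + Complex.I • G‖ ^ 2 = ‖H‖ ^ 2 + ‖G‖ ^ 2 := by
  have hconj : ‖H + Complex.I • G‖ = ‖H - Complex.I • G‖ := by
    rw [← Matrix.frobenius_norm_conjTranspose, Matrix.conjTranspose_add,
      Matrix.conjTranspose_smul, hH.eq, hG.eq, Complex.star_def, Complex.conj_I, neg_smul,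
      ← sub_eq_add_neg]
  have hpar : ‖H + Complex.I • G‖ ^ 2 + ‖H - Complex.I • G‖ ^ 2 = 2 * (‖H‖ ^ 2 + ‖G‖ ^ 2) := by
    simp only [frobenius_norm_sq, ← Finset.sum_add_distrib, Finset.mul_sum]
    refine Finset.sum_congr rfl fun i _ => Finset.sum_congr rfl fun j _ => ?_
    simpa using parallelogram_law_with_norm ℝ (H i j) (Complex.I * G i j)
  rw [← hconj] at hpar
  linarith

theorem norm_realify_vec (M : Matrix (Fin n) (Fin n) ℂ) :
    ‖WithLp.toLp 2 (realify M.vec)‖ = ‖M‖ := by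
  refine (sq_eq_sq₀ (norm_nonneg _) (norm_nonneg _)).1 ?_
  rw [EuclideanSpace.norm_sq_eq, frobenius_norm_sq, Finset.sum_comm, ← Fintype.sum_prod_type',
    Fintype.sum_sum_type, ← Finset.sum_add_distrib]
  refine Finset.sum_congr rfl fun k _ => ?_
  rw [Complex.sq_norm, Complex.normSq_apply]
  simp [realify_inl, realify_inr, sq]

/-- `vec` followed by taking real and imaginary parts, as an isometry for the Frobenius norm. -/
def realVec (n : ℕ) : Matrix (Fin n) (Fin n) ℂ ≃ₗᵢ[ℝ] EuclideanSpace ℝ (RealIndex n) where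
  toFun M := WithLp.toLp 2 (realify M.vec)
  invFun w := Matrix.of fun i j => ⟨w (.inl (j, i)), w (.inr (j, i))⟩
  map_add' M N := by ext (k | k) <;> simp [realify_inl, realify_inr]
  map_smul' t M := by ext (k | k) <;> simp [realify_inl, realify_inr]
  left_inv M := rfl
  right_inv w := by ext (k | k) <;> rfl
  norm_map' := norm_realify_vec

theorem realVec_apply (M : Matrix (Fin n) (Fin n) ℂ) :
    realVec n M = WithLp.toLp 2 (realify M.vec) :=
  rfl

/-- The space of real coordinate vectors of perturbations `(ΔA₁, …, ΔAₘ, ΔQ)`, with the block of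
`ΔQ` first, in the order of the blocks of `(ρ S_c, η₁ U₁, …, ηₘ Uₘ)`. -/
abbrev PerturbationSpace (m n : ℕ) := EuclideanSpace ℝ (RealIndex n ⊕ Fin m × RealIndex n)

/-- The subvector of a Euclidean vector with coordinates `e k`. -/
def subvector {α β : Type*} (e : α → β) :
    EuclideanSpace ℝ β →L[ℝ] EuclideanSpace ℝ α where
  toFun w := WithLp.toLp 2 fun k => w (e k)
  map_add' _ _ := rfl
  map_smul' _ _ := rfl
  cont := by fun_prop

theorem subvector_apply {α β : Type*} (e : α → β)
    (w : EuclideanSpace ℝ β) (k : α) : subvector e w k = w (e k) :=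
  rfl

/-- The perturbation `(ΔA, ΔQ)` whose weighted components `ΔAᵢ / ηᵢ` and `ΔQ / ρ` have the given
real coordinates. -/
def perturbation (η : Fin m → ℝ) (ρ : ℝ) :
    PerturbationSpace m n →L[ℝ]
      (Fin m → Matrix (Fin n) (Fin n) ℂ) × Matrix (Fin n) (Fin n) ℂ :=
  let mat : EuclideanSpace ℝ (RealIndex n) →L[ℝ] Matrix (Fin n) (Fin n) ℂ :=
    (realVec n).symm.toContinuousLinearEquiv.toContinuousLinearMap
  (ContinuousLinearMap.pi fun i => η i • mat ∘L subvector fun k => .inr (i, k)).prod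
    (ρ • mat ∘L subvector .inl)

/-- The real coordinates of the perturbation `(η₁ E₁, …, ηₘ Eₘ, ρ F)`. -/
def coordinates (E : Fin m → Matrix (Fin n) (Fin n) ℂ) (F : Matrix (Fin n) (Fin n) ℂ) :
    PerturbationSpace m n :=
  WithLp.toLp 2 (Sum.elim (realVec n F) fun p => realVec n (E p.1) p.2)

theorem perturbation_coordinates (η : Fin m → ℝ) (ρ : ℝ) (E : Fin m → Matrix (Fin n) (Fin n) ℂ)
    (F : Matrix (Fin n) (Fin n) ℂ) :
    perturbation η ρ (coordinates E F) = (fun i => η i • E i, ρ • F) :=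
  rfl

theorem coordinates_surjective (w : PerturbationSpace m n) : ∃ E F, coordinates E F = w := by
  refine ⟨fun i => (realVec n).symm (subvector (fun k => .inr (i, k)) w),
    (realVec n).symm (subvector .inl w), ?_⟩
  ext (k | k) <;> simp [coordinates, subvector_apply]

theorem norm_coordinates_sq (E : Fin m → Matrix (Fin n) (Fin n) ℂ)
    (F : Matrix (Fin n) (Fin n) ℂ) :
    ‖coordinates E F‖ ^ 2 = ‖F‖ ^ 2 + ∑ i, ‖E i‖ ^ 2 := by
  simp only [← (realVec n).norm_map, EuclideanSpace.norm_sq_eq, Fintype.sum_sum_type,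
    Fintype.sum_prod_type]
  rfl

theorem perturbationNorm_eq (η : Fin m → ℝ) (ρ : ℝ) (E : Fin m → Matrix (Fin n) (Fin n) ℂ)
    (F : Matrix (Fin n) (Fin n) ℂ) :
    perturbationNorm η ρ E F = ‖coordinates (fun i => (η i)⁻¹ • E i) (ρ⁻¹ • F)‖ := by
  refine (sq_eq_sq₀ (norm_nonneg (Matrix.fromCols _ _)) (norm_nonneg _)).1 ?_
  rw [norm_coordinates_sq]
  simp only [frobenius_norm_sq, Fintype.sum_sum_type, Finset.sum_add_distrib,
    Matrix.fromCols_apply_inl, Matrix.fromCols_apply_inr, Fintype.sum_prod_type]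
  rw [Finset.sum_comm, add_comm]
  rfl

end Realification

section ConditionMatrix

open scoped Matrix.Norms.Frobenius

variable {m n : ℕ} {A : Fin m → Matrix (Fin n) (Fin n) ℂ} {Q X : Matrix (Fin n) (Fin n) ℂ}

theorem matSc_mulVec_realify (v : Fin n × Fin n → ℂ) :
    matSc A X *ᵥ realify v = realify ((matL A X)⁻¹ *ᵥ v) := by
  have h := fromBlocks_mulVec_realify (matL A X)⁻¹ 0 v
  simpa [rePart, imPart, matSc, Matrix.map_zero] using h

theorem matU_mulVec_realify_vec (i : Fin m) (E : Matrix (Fin n) (Fin n) ℂ) :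
    matU A X i *ᵥ realify E.vec =
      realify ((matL A X)⁻¹ *ᵥ (Eᴴ * matB A X i + (matB A X i)ᴴ * E).vec) := by
  have hstar : vecPerm n *ᵥ star E.vec = Eᴴ.vec := vecPerm_mulVec_vec (E.map star)
  rw [matU, fromBlocks_mulVec_realify, matV1, matV2, ← Matrix.mulVec_mulVec,
    ← Matrix.mulVec_mulVec, ← Matrix.mulVec_mulVec, hstar, Matrix.kronecker_mulVec_vec,
    Matrix.kronecker_mulVec_vec, ← Matrix.mulVec_add, Matrix.vec_add, add_comm]
  simp

theorem blockRow_mulVec {r c : Type*} [Fintype c] (M : Fin m → Matrix r c ℝ)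
    (y : Fin m × c → ℝ) : blockRow M *ᵥ y = ∑ i, M i *ᵥ fun j => y (i, j) := by
  ext k
  simp [Matrix.mulVec, dotProduct, blockRow, Fintype.sum_prod_type]

theorem realVec_solutionDeriv (hQ : Q.PosDef) (hX : IsPosDefSolution A Q X)
    (p : (Fin m → Matrix (Fin n) (Fin n) ℂ) × Matrix (Fin n) (Fin n) ℂ) :
    realVec n (solutionDeriv (matB A X) p) =
      WithLp.toLp 2 (realify ((matL A X)⁻¹ *ᵥ (sourceMap (matB A X) p).vec)) := by
  have hdet := (Matrix.isUnit_iff_isUnit_det _).1 (hX.isUnit_matL hQ)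
  rw [← steinMap_solutionDeriv (hX.isInvertible_steinMap hQ), ← matL_mulVec_vec,
    Matrix.mulVec_mulVec, Matrix.nonsing_inv_mul _ hdet, Matrix.one_mulVec, realVec_apply]

/-- The linear map between Euclidean spaces given by the matrix `(ρ S_c, η₁ U₁, …, ηₘ Uₘ)`. -/
def condOperator (η : Fin m → ℝ) (ρ : ℝ) (A : Fin m → Matrix (Fin n) (Fin n) ℂ)
    (X : Matrix (Fin n) (Fin n) ℂ) :
    PerturbationSpace m n →L[ℝ] EuclideanSpace ℝ (RealIndex n) :=
  (Matrix.toEuclideanLin (Matrix.fromCols (ρ • matSc A X)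
    (blockRow fun i => η i • matU A X i))).toContinuousLinearMap

theorem norm_condOperator (η : Fin m → ℝ) (ρ : ℝ) :
    ‖condOperator η ρ A X‖ = specNorm (Matrix.fromCols (ρ • matSc A X)
      (blockRow fun i => η i • matU A X i)) :=
  rfl

theorem IsPosDefSolution.condOperator_apply (hQ : Q.PosDef) (hX : IsPosDefSolution A Q X)
    (η : Fin m → ℝ) (ρ : ℝ) (w : PerturbationSpace m n) :
    condOperator η ρ A X w =
      realVec n (solutionDeriv (matB A X) (perturbation η ρ w)) := by
  obtain ⟨E, F, rfl⟩ := coordinates_surjective w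
  have hsource : (sourceMap (matB A X) (fun i => η i • E i, ρ • F)).vec =
      ρ • F.vec + ∑ i, η i • ((E i)ᴴ * matB A X i + (matB A X i)ᴴ * E i).vec := by
    simp [sourceMap_apply, Matrix.star_eq_conjTranspose, Matrix.vec_sum, smul_add]
  rw [perturbation_coordinates, realVec_solutionDeriv hQ hX, hsource, Matrix.mulVec_add,
    Matrix.mulVec_sum, map_add, map_sum]
  simp only [Matrix.mulVec_smul, map_smul, ← matU_mulVec_realify_vec]
  simp [condOperator, coordinates, blockRow_mulVec, realVec_apply, Matrix.smul_mulVec,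
    matSc_mulVec_realify]

/-- The coordinate vectors of perturbations `(ΔA, ΔQ)` with `ΔQ` Hermitian. -/
def hermitianSubspace (m n : ℕ) : Submodule ℝ (PerturbationSpace m n) :=
  (selfAdjoint.submodule ℝ (Matrix (Fin n) (Fin n) ℂ)).comap
    ((realVec n).symm.toLinearEquiv.toLinearMap ∘ₗ (subvector .inl).toLinearMap)

theorem coordinates_mem_hermitianSubspace {E : Fin m → Matrix (Fin n) (Fin n) ℂ}
    {F : Matrix (Fin n) (Fin n) ℂ} : coordinates E F ∈ hermitianSubspace m n ↔ F.IsHermitian :=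
  Iff.rfl

/-- Split `ΔQ` into its Hermitian and skew-Hermitian parts: they are orthogonal, and so are their
images. -/
theorem IsPosDefSolution.norm_condOperator_comp_subtypeL (hQ : Q.PosDef)
    (hX : IsPosDefSolution A Q X) (η : Fin m → ℝ) (ρ : ℝ) :
    ‖condOperator η ρ A X ∘L (hermitianSubspace m n).subtypeL‖ = ‖condOperator η ρ A X‖ := by
  refine norm_comp_subtypeL_eq _ _ fun w => ?_
  obtain ⟨E, F, rfl⟩ := coordinates_surjective w
  obtain ⟨H, G, hH, hG, rfl⟩ : ∃ H G : Matrix (Fin n) (Fin n) ℂ,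
      H.IsHermitian ∧ G.IsHermitian ∧ H + Complex.I • G = F :=
    ⟨realPart F, imaginaryPart F, (realPart F).2, (imaginaryPart F).2,
      realPart_add_I_smul_imaginaryPart F⟩
  refine ⟨coordinates E H, hH, coordinates 0 G, hG, ?_, le_of_eq ?_⟩
  · simp only [norm_coordinates_sq, frobenius_norm_add_I_smul_sq hH hG, Pi.zero_apply, norm_zero,
      ne_eq, OfNat.ofNat_ne_zero, not_false_eq_true, zero_pow, Finset.sum_const_zero, add_zero]
    ring
  · have hinv := hX.isInvertible_steinMap hQ
    simp only [hX.condOperator_apply hQ, LinearIsometryEquiv.norm_map, perturbation_coordinates,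
      smul_add, smul_comm ρ Complex.I, solutionDeriv_add_I_smul]
    rw [frobenius_norm_add_I_smul_sq (isSelfAdjoint_solutionDeriv hinv _ (.smul (.all ρ) hH))
      (isSelfAdjoint_solutionDeriv hinv _ (.smul (.all ρ) hG))]
    simp only [Pi.zero_apply, smul_zero]
    rfl

end ConditionMatrix

section ConditionNumber

open scoped Matrix.Norms.Frobenius

variable {m n : ℕ} {A : Fin m → Matrix (Fin n) (Fin n) ℂ} {Q X : Matrix (Fin n) (Fin n) ℂ}
  {ξ ρ : ℝ} {η : Fin m → ℝ}

theorem isHermitian_perturbation_snd {w : PerturbationSpace m n} (hw : w ∈ hermitianSubspace m n) :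
    (perturbation η ρ w).2.IsHermitian := by
  obtain ⟨E, F, rfl⟩ := coordinates_surjective w
  exact IsSelfAdjoint.smul (.all ρ) (coordinates_mem_hermitianSubspace.1 hw)

theorem perturbationSup_eq
    {φ : (Fin m → Matrix (Fin n) (Fin n) ℂ) × Matrix (Fin n) (Fin n) ℂ → Matrix (Fin n) (Fin n) ℂ}
    {δ : ℝ} (hρ : ρ ≠ 0) (hη : ∀ i, η i ≠ 0)
    (hφ : ∀ w ∈ hermitianSubspace m n, ‖w‖ ≤ δ → (Q + (perturbation η ρ w).2).PosDef ∧
      IsPosDefSolution (A + (perturbation η ρ w).1) (Q + (perturbation η ρ w).2)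
        (φ ((A, Q) + perturbation η ρ w))) :
    perturbationSup ξ η ρ A Q X δ = ⨆ (w : hermitianSubspace m n) (_ : ‖w‖ ≤ δ),
      ENNReal.ofReal (‖φ ((A, Q) + perturbation η ρ w) - X‖ / (ξ * δ)) := by
  refine le_antisymm (iSup₂_le fun ΔA ΔQ => iSup₂_le fun ΔX ⟨hδ, hherm, hpos, hsol⟩ => ?_)
    (iSup₂_le fun ⟨w, hw⟩ hwδ => ?_)
  · set w := coordinates (fun i => (η i)⁻¹ • ΔA i) (ρ⁻¹ • ΔQ) with hw_def
    have hw : w ∈ hermitianSubspace m n :=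
      coordinates_mem_hermitianSubspace.2 (IsSelfAdjoint.smul (.all ρ⁻¹) hherm)
    have hpert : perturbation η ρ w = (ΔA, ΔQ) := by
      simp [hw_def, perturbation_coordinates, smul_smul, hρ, hη]
    rw [perturbationNorm_eq] at hδ
    have hφw := (hφ w hw hδ).2
    rw [hpert] at hφw
    refine le_iSup₂_of_le ⟨w, hw⟩ hδ (le_of_eq ?_)
    rw [hpert, hφw.eq hpos hsol, add_sub_cancel_left]
    rfl
  · obtain ⟨hpos, hsol⟩ := hφ w hw hwδ
    obtain ⟨E, F, rfl⟩ := coordinates_surjective w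
    refine le_iSup₂_of_le (perturbation η ρ (coordinates E F)).1
      (perturbation η ρ (coordinates E F)).2 (le_iSup₂_of_le
        (φ ((A, Q) + perturbation η ρ (coordinates E F)) - X) ⟨?_,
        isHermitian_perturbation_snd hw, hpos, ?_⟩ le_rfl)
    · simpa [perturbationNorm_eq, perturbation_coordinates, smul_smul, hρ, hη] using hwδ
    · rwa [add_sub_cancel]

theorem IsPosDefSolution.isConditionNumber (hQ : Q.PosDef) (hX : IsPosDefSolution A Q X)
    (hξ : 0 < ξ) (hρ : ρ ≠ 0) (hη : ∀ i, η i ≠ 0) :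
    IsConditionNumber ξ η ρ A Q X
      (ENNReal.ofReal ((1 / ξ) * specNorm (Matrix.fromCols (ρ • matSc A X)
        (blockRow fun i => η i • matU A X i)))) := by
  obtain ⟨φ, hφX, hφ, hsol⟩ := hX.exists_hasFDerivAt hQ
  let p (w : hermitianSubspace m n) := (A, Q) + perturbation η ρ w
  let f (w : hermitianSubspace m n) := realVec n (φ (p w))
  have hp0 : p 0 = (A, Q) := by simp [p]
  have hp : HasFDerivAt p (perturbation η ρ ∘L (hermitianSubspace m n).subtypeL) 0 :=
    (perturbation η ρ ∘L (hermitianSubspace m n).subtypeL).hasFDerivAt.const_add (A, Q)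
  have hf : HasFDerivAt f (condOperator η ρ A X ∘L (hermitianSubspace m n).subtypeL) 0 := by
    rw [← hp0] at hφ
    refine ((realVec n).toContinuousLinearEquiv.hasFDerivAt.comp 0 (hφ.comp 0 hp)).congr_fderiv ?_
    ext1 w
    exact (hX.condOperator_apply hQ η ρ w).symm
  have hnear : ∀ᶠ w in 𝓝 (0 : hermitianSubspace m n),
      (p w).2.PosDef ∧ IsPosDefSolution (p w).1 (p w).2 (φ (p w)) := by
    have hherm (w) : (p w).2.IsHermitian :=
      hQ.isHermitian.add (isHermitian_perturbation_snd (SetLike.coe_mem w))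
    have hpos := (continuous_snd.tendsto (A, Q)).eventually (eventually_posDef hQ)
    have hcont : Tendsto p (𝓝 0) (𝓝 (A, Q)) := hp0 ▸ hp.continuousAt.tendsto
    filter_upwards [hcont.eventually (hpos.and hsol)] with w ⟨hpw, hsw⟩
    exact ⟨hpw (hherm w), hsw (hherm w)⟩
  obtain ⟨r, hr, hball⟩ := Metric.eventually_nhds_iff_ball.1 hnear
  have hlim := tendsto_iSup_norm_sub_div_mul hf hξ
  rw [hX.norm_condOperator_comp_subtypeL hQ, norm_condOperator] at hlim
  refine hlim.congr' ?_
  filter_upwards [Ioo_mem_nhdsGT hr] with δ ⟨_, hδr⟩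
  rw [perturbationSup_eq hρ hη fun w hw hwδ =>
    hball ⟨w, hw⟩ (mem_ball_zero_iff.2 (hwδ.trans_lt hδr))]
  refine iSup_congr fun w => iSup_congr fun _ => ?_
  rw [zero_add, ← map_sub, LinearIsometryEquiv.norm_map, hp0, hφX]

end ConditionNumber

end MatrixCond

end

theorem theorem6p1 {m n : ℕ} (A : Fin m → Matrix (Fin n) (Fin n) ℂ)
    (Q : Matrix (Fin n) (Fin n) ℂ) (hQ : Q.PosDef)
    (ξ ρ : ℝ) (η : Fin m → ℝ) (hξ : 0 < ξ) (hρ : 0 < ρ) (hη : ∀ i, 0 < η i) :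
    ∃ X : Matrix (Fin n) (Fin n) ℂ,
      MatrixCond.IsPosDefSolution A Q X ∧
      (∀ Y, MatrixCond.IsPosDefSolution A Q Y → Y = X) ∧
      IsUnit (MatrixCond.matL A X) ∧
      MatrixCond.IsConditionNumber ξ η ρ A Q X
        (ENNReal.ofReal ((1 / ξ) * MatrixCond.specNorm
          (Matrix.fromCols (ρ • MatrixCond.matSc A X)
            (MatrixCond.blockRow fun i => η i • MatrixCond.matU A X i)))) := by
  obtain ⟨X, hX⟩ := MatrixCond.exists_isPosDefSolution A hQ
  exact ⟨X, hX, fun Y hY => hY.eq hQ hX, hX.isUnit_matL hQ,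
    hX.isConditionNumber hQ hξ hρ.ne' fun i => (hη i).ne'⟩
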